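/- Let $(c_n)_{n\ge 0}$ be a sequence of real numbers such that the power series $F(z)=\sum_{n=0}^{\infty}c_nz^n$ converges (and so is analytic) on the open unit disc $\mathbb{D}$, and let $U=\operatorname{Re}F$. Suppose that $U$ has $L^1_{loc}$-boundary behavior on $\partial\mathbb{D}\setminus\{1\}$, that is, there is a function $f$ on $\partial\mathbb{D}\setminus\{1\}$ such that for every closed arc $\{e^{i\theta}:\alpha\le\theta\le\beta\}$ contained in $\partial\mathbb{D}\setminus\{1\}$ the function $\theta\mapsto f(e^{i\theta})$ is integrable on $[\alpha,\beta]$ and $$\lim_{r\to1^-}\int_\alpha^\beta\left|U(re^{i\theta})-f(e^{i\theta})\right|\,\mathrm{d}\theta=0 .$$ Suppose moreover that there is some $\theta_0\in(0,\pi)$ such that one of the following three conditions holds: - (b.1) there is a constant $C\ge0$ such that $U(re^{i\theta})\ge -C$ for all $\theta\in(-\theta_0,\theta_0)$ and $r\in[0,1)$; - (b.2) $\displaystyle\sup_{0<r<1}\int_{-\theta_0}^{\theta_0}|U(re^{i\theta})|\,\mathrm{d}\theta<\infty$; - (b.3) there are $g\in L^1(-\theta_0,\theta_0)$, $k\in\mathbb{N}$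 and a constant $C$ such that $|U(re^{i\theta})|\le C(1-r)^{-k}$ for all $\theta\in(-\theta_0,\theta_0)$ and $r\in[0,1)$, and, for each $r\in[0,1)$, $U(re^{i\theta})\ge g(\theta)$ for a.e. $\theta\in(-\theta_0,\theta_0)$. Then $(c_n)$ converges to a finite limit, the limit $\lim_{r\to1^-}(1-r)U(r)$ exists, and $$\lim_{n\to\infty}c_n=\lim_{r\to1^-}(1-r)U(r).$$ -/

import Mathlib

open Filter Topology MeasureTheory

/-- A function `U` on the open unit disc has `L¹_loc`-boundary behavior on a (relatively open)
subset `E` of the unit circle: there is a boundary function `f`, integrable over every closed arc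
`{e^{iθ} : α ≤ θ ≤ β}` contained in `E`, such that over each of these arcs
`∫ |U(re^{iθ}) - f(e^{iθ})| dθ → 0` as `r → 1⁻`. -/
def HasL1LocBoundaryBehavior (U : ℂ → ℝ) (E : Set ℂ) : Prop :=
  ∃ f : ℂ → ℝ, ∀ α β : ℝ, α ≤ β →
    (∀ θ ∈ Set.Icc α β, Complex.exp (θ * Complex.I) ∈ E) →
      IntervalIntegrable (fun θ : ℝ => f (Complex.exp (θ * Complex.I))) volume α β ∧
      Tendsto (fun r : ℝ => ∫ θ in α..β,
          |U (r * Complex.exp (θ * Complex.I)) - f (Complex.exp (θ * Complex.I))|)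
        (𝓝[<] 1) (𝓝 0)

/-! Write `u r θ` for `∑ c n r ^ n cos (n θ)`. Each condition near `1` yields bounded `L¹` means on
the whole circle: the integral of `u r` is always `2π c 0`, so a lower bound controls the absolute
integral. Then the boundary function `φ` is integrable on `(0, 2π)`, although `u r` may still
concentrate mass at the point `1`. Testing against `cos (n θ) - 1`, which vanishes there, hides this
mass: for `n ≠ 0`, `π c n = 2π c 0 + ∫ φ (cos (n θ) - 1)`. Riemann–Lebesgue makes the right side
converge, and Abel's theorem, applied to the differences of `c`, identifies the limit. -/

theorem tendsto_one_sub_mul_of_tendsto {c : ℕ → ℝ} {a : ℝ} {s : ℝ → ℝ}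
    (hs : ∀ r ∈ Set.Ico (0 : ℝ) 1, HasSum (fun n => c n * r ^ n) (s r))
    (hc : Tendsto c atTop (𝓝 a)) :
    Tendsto (fun r => (1 - r) * s r) (𝓝[<] 1) (𝓝 a) := by
  -- The partial sums of `b` are the `c n`, and its power series is `(1 - r) * s r`.
  let b : ℕ → ℝ := fun n => if n = 0 then c 0 else c n - c (n - 1)
  have hb : ∀ n, ∑ i ∈ Finset.range (n + 1), b i = c n := by
    intro n
    induction n with
    | zero => simp [b]
    | succ n ih => rw [Finset.sum_range_succ, ih]; simp [b]
  have hsum : Tendsto (fun n => ∑ i ∈ Finset.range n, b i) atTop (𝓝 a) := by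
    rw [← tendsto_add_atTop_iff_nat 1]
    simpa only [hb] using hc
  refine (Real.tendsto_tsum_powerSeries_nhdsWithin_lt hsum).congr' ?_
  filter_upwards [Ioo_mem_nhdsLT (zero_lt_one' ℝ)] with r hr
  refine HasSum.tsum_eq ?_
  have h0 := hs r ⟨hr.1.le, hr.2⟩
  have h1 : HasSum (fun n => if n = 0 then 0 else c (n - 1) * r ^ n) (r * s r) := by
    rw [← hasSum_nat_add_iff' 1]
    simp only [Finset.range_one, Finset.sum_singleton, if_true, sub_zero]
    refine (h0.mul_left r).congr_fun ?_
    intro n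
    simp [pow_succ]; ring
  have h2 := h0.sub h1
  rw [show (1 - r) * s r = s r - r * s r by ring]
  refine h2.congr_fun ?_
  intro n
  rcases n with _ | n
  · simp [b]
  · simp [b]; ring

/-! ### Riemann–Lebesgue and limits of integrals -/

theorem tendsto_integral_mul_cos_nat {φ : ℝ → ℝ} {a b : ℝ} (hab : a ≤ b)
    (hφ : IntervalIntegrable φ volume a b) :
    Tendsto (fun n : ℕ => ∫ θ in a..b, φ θ * Real.cos (n * θ)) atTop (𝓝 0) := by
  have h := Real.tendsto_integral_exp_smul_cocompact
    ((Set.Ioc a b).indicator fun θ => (φ θ : ℂ))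
  -- The Fourier character is `exp (2πi x)`, hence the frequency `n / 2π`.
  have hn : Tendsto (fun n : ℕ => (n : ℝ) / (2 * Real.pi)) atTop (cocompact ℝ) :=
    (tendsto_natCast_atTop_atTop.atTop_div_const (by positivity)).mono_right atTop_le_cocompact
  have h2 := (Complex.continuous_re.tendsto _).comp (h.comp hn)
  rw [Complex.zero_re] at h2
  refine h2.congr fun n => ?_
  simp only [Function.comp_apply]
  have hint : IntegrableOn (fun θ => (φ θ : ℂ)) (Set.Ioc a b) :=
    ((intervalIntegrable_iff_integrableOn_Ioc_of_le hab).1 hφ).ofReal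
  rw [intervalIntegral.integral_of_le hab, ← integral_indicator measurableSet_Ioc]
  have hI := (Real.fourierIntegral_convergent_iff (μ := volume)
    (f := (Set.Ioc a b).indicator fun θ => (φ θ : ℂ)) ((n : ℝ) / (2 * Real.pi))).2
      (hint.integrable_indicator measurableSet_Ioc)
  have hI' : Integrable (fun v : ℝ => Real.fourierChar (-(v * (n / (2 * Real.pi)))) •
      (Set.Ioc a b).indicator (fun θ => (φ θ : ℂ)) v) := by
    simpa [mul_comm] using hI
  have := integral_re hI'
  simp only [RCLike.re_to_complex] at this
  rw [← this]
  refine integral_congr_ae (Eventually.of_forall fun θ => ?_)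
  by_cases hθ : θ ∈ Set.Ioc a b
  · simp only [Set.indicator_of_mem hθ, Circle.smul_def, Real.fourierChar_apply, smul_eq_mul]
    have e : 2 * Real.pi * -(θ * (n / (2 * Real.pi))) = -(n * θ) := by
      field_simp
    rw [e, Complex.re_mul_ofReal, Complex.exp_ofReal_mul_I_re, Real.cos_neg, mul_comm]
  · simp [Set.indicator_of_notMem hθ]

/-- Inside, `h` is bounded and `L¹` convergence applies; near the endpoints `h` is small and the
`L¹` norms of `u r - φ` are bounded. -/
theorem tendsto_intervalIntegral_mul_of_vanish_endpoints {l : Filter ℝ} {u : ℝ → ℝ → ℝ}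
    {φ h : ℝ → ℝ} {a b M : ℝ} (hab : a < b)
    (hu : ∀ᶠ r in l, Continuous (u r))
    (hM : ∀ᶠ r in l, ∫ θ in a..b, |u r θ| ≤ M)
    (hφ : IntervalIntegrable φ volume a b) (hh : Continuous h) (ha : h a = 0) (hb : h b = 0)
    (hlim : ∀ a' b', a < a' → a' ≤ b' → b' < b →
      Tendsto (fun r => ∫ θ in a'..b', |u r θ - φ θ|) l (𝓝 0)) :
    Tendsto (fun r => ∫ θ in a..b, u r θ * h θ) l (𝓝 (∫ θ in a..b, φ θ * h θ)) := by
  obtain ⟨K, hK⟩ := (isCompact_Icc (a := a) (b := b)).exists_bound_of_continuousOn hh.continuousOn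
  have hK0 : 0 ≤ K := (norm_nonneg _).trans (hK a ⟨le_rfl, hab.le⟩)
  set N := ∫ θ in a..b, |φ θ| with hN
  have hN0 : 0 ≤ N := intervalIntegral.integral_nonneg hab.le fun _ _ => abs_nonneg _
  rw [Metric.tendsto_nhds]
  intro ε hε
  -- `|M| + N` bounds the `L¹` norm of `u r - φ`; the `+ 1` keeps the denominator positive.
  set η := ε / (2 * (|M| + N + 1)) with hη
  have hη0 : 0 < η := by positivity
  obtain ⟨δ₁, hδ₁, h₁⟩ := Metric.continuous_iff.1 hh a η hη0
  obtain ⟨δ₂, hδ₂, h₂⟩ := Metric.continuous_iff.1 hh b η hη0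
  obtain ⟨δ, hδ0, hδ⟩ := exists_between (show 0 < min (min δ₁ δ₂) ((b - a) / 2) by
    have := sub_pos.2 hab
    positivity)
  simp only [lt_min_iff] at hδ
  have hl := hlim (a + δ) (b - δ) (by linarith) (by linarith) (by linarith)
  have hl' := (hl.const_mul K).eventually_lt_const (show K * 0 < ε / 2 by simpa using hε)
  filter_upwards [hu, hM, hl'] with r hur hMr hlr
  have hui : IntervalIntegrable (u r) volume a b := hur.intervalIntegrable _ _
  have hG : IntervalIntegrable (fun θ => |u r θ - φ θ|) volume a b := (hui.sub hφ).abs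
  have hGi : IntegrableOn (fun θ => |u r θ - φ θ|) (Set.Ioc a b) :=
    (intervalIntegrable_iff_integrableOn_Ioc_of_le hab.le).1 hG
  rw [Real.dist_eq, ← intervalIntegral.integral_sub (hui.mul_continuousOn hh.continuousOn)
    (hφ.mul_continuousOn hh.continuousOn)]
  have hsub : Set.Ioc (a + δ) (b - δ) ⊆ Set.Ioc a b :=
    Set.Ioc_subset_Ioc (by linarith) (by linarith)
  have key : |∫ θ in a..b, u r θ * h θ - φ θ * h θ| ≤
      K * (∫ θ in (a + δ)..(b - δ), |u r θ - φ θ|) + η * ∫ θ in a..b, |u r θ - φ θ| := by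
    refine (intervalIntegral.abs_integral_le_integral_abs hab.le).trans ?_
    rw [intervalIntegral.integral_of_le hab.le, intervalIntegral.integral_of_le hab.le,
      intervalIntegral.integral_of_le (by linarith : a + δ ≤ b - δ),
      ← Set.inter_eq_self_of_subset_right hsub, ← setIntegral_indicator measurableSet_Ioc,
      ← integral_const_mul, ← integral_const_mul, ← integral_add]
    · refine setIntegral_mono_on ?_ ?_ measurableSet_Ioc fun θ hθ => ?_
      · exact ((intervalIntegrable_iff_integrableOn_Ioc_of_le hab.le).1
          ((hui.mul_continuousOn hh.continuousOn).sub
            (hφ.mul_continuousOn hh.continuousOn))).abs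
      · exact ((hGi.indicator measurableSet_Ioc).const_mul _).add (hGi.const_mul _)
      · rw [← sub_mul, abs_mul]
        have hKθ := hK θ ⟨hθ.1.le, hθ.2⟩
        rw [Real.norm_eq_abs] at hKθ
        have hp := abs_nonneg (u r θ - φ θ)
        by_cases hm : θ ∈ Set.Ioc (a + δ) (b - δ)
        · rw [Set.indicator_of_mem hm]
          nlinarith
        · rw [Set.indicator_of_notMem hm, mul_zero, zero_add, mul_comm]
          refine mul_le_mul_of_nonneg_right ?_ hp
          rw [Set.mem_Ioc, not_and_or, not_lt, not_le] at hm
          rcases hm with hm | hm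
          · have := h₁ θ (by rw [Real.dist_eq, abs_lt]; constructor <;> linarith [hθ.1])
            rw [ha, Real.dist_eq, sub_zero] at this
            exact this.le
          · have := h₂ θ (by rw [Real.dist_eq, abs_lt]; constructor <;> linarith [hθ.2])
            rw [hb, Real.dist_eq, sub_zero] at this
            exact this.le
    · exact (hGi.indicator measurableSet_Ioc).const_mul _
    · exact hGi.const_mul _
  have hGle : ∫ θ in a..b, |u r θ - φ θ| ≤ |M| + N := by
    calc ∫ θ in a..b, |u r θ - φ θ| ≤ ∫ θ in a..b, (|u r θ| + |φ θ|) :=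
          intervalIntegral.integral_mono_on hab.le hG (hui.abs.add hφ.abs) fun θ _ => abs_sub _ _
      _ = (∫ θ in a..b, |u r θ|) + N := intervalIntegral.integral_add hui.abs hφ.abs
      _ ≤ |M| + N := by linarith [le_abs_self M]
  have : η * (∫ θ in a..b, |u r θ - φ θ|) ≤ ε / 2 := by
    calc η * (∫ θ in a..b, |u r θ - φ θ|) ≤ η * (|M| + N + 1) := by gcongr; linarith
      _ = ε / 2 := by rw [hη]; field_simp
  linarith

/-! ### Cosine series and their coefficients -/

theorem integral_cos_int_mul (k : ℤ) :
    ∫ θ in (0 : ℝ)..2 * Real.pi, Real.cos (k * θ) = if k = 0 then 2 * Real.pi else 0 := by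
  split_ifs with hk
  · simp [hk]
  · have hk' : (k : ℝ) ≠ 0 := by exact_mod_cast hk
    rw [intervalIntegral.integral_comp_mul_left (fun x => Real.cos x) hk', integral_cos]
    have := Real.sin_int_mul_pi (2 * k)
    push_cast at this
    rw [show (k : ℝ) * (2 * Real.pi) = 2 * k * Real.pi by ring, this]
    simp

theorem integral_cos_mul_cos_nat (m n : ℕ) :
    ∫ θ in (0 : ℝ)..2 * Real.pi, Real.cos (m * θ) * Real.cos (n * θ) =
      if m = n then (if n = 0 then 2 * Real.pi else Real.pi) else 0 := by
  have h : ∀ θ : ℝ, Real.cos (m * θ) * Real.cos (n * θ) =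
      (Real.cos (((m - n : ℤ) : ℝ) * θ) + Real.cos (((m + n : ℤ) : ℝ) * θ)) * (1 / 2) := by
    intro θ
    push_cast
    rw [sub_mul, add_mul _ _ θ, Real.cos_sub, Real.cos_add]
    ring
  simp_rw [h]
  rw [intervalIntegral.integral_mul_const, intervalIntegral.integral_add
    (Continuous.intervalIntegrable (by fun_prop) _ _)
    (Continuous.intervalIntegrable (by fun_prop) _ _), integral_cos_int_mul, integral_cos_int_mul]
  by_cases hmn : m = n
  · subst hmn
    by_cases hm : m = 0
    · simp only [hm, Nat.cast_zero, sub_zero, add_zero, if_true]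
      ring
    · have : (m : ℤ) + m ≠ 0 := by omega
      rw [sub_self, if_pos rfl, if_neg this, if_pos rfl, if_neg hm]
      ring
  · have h1 : (m : ℤ) - n ≠ 0 := by omega
    have h2 : (m : ℤ) + n ≠ 0 := by omega
    rw [if_neg h1, if_neg h2, if_neg hmn]
    ring

theorem continuous_of_hasSum_mul_cos {b : ℕ → ℝ} {v : ℝ → ℝ} (hb : Summable fun n => |b n|)
    (hv : ∀ θ, HasSum (fun n : ℕ => b n * Real.cos (n * θ)) (v θ)) : Continuous v := by
  have : v = fun θ => ∑' n : ℕ, b n * Real.cos (n * θ) := funext fun θ => (hv θ).tsum_eq.symm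
  rw [this]
  refine continuous_tsum (fun n => by fun_prop) hb fun n θ => ?_
  rw [Real.norm_eq_abs, abs_mul]
  exact mul_le_of_le_one_right (abs_nonneg _) (Real.abs_cos_le_one _)

theorem integral_mul_cos_of_hasSum_mul_cos {b : ℕ → ℝ} {v : ℝ → ℝ}
    (hb : Summable fun n => |b n|)
    (hv : ∀ θ, HasSum (fun n : ℕ => b n * Real.cos (n * θ)) (v θ)) (n : ℕ) :
    ∫ θ in (0 : ℝ)..2 * Real.pi, v θ * Real.cos (n * θ) =
      b n * if n = 0 then 2 * Real.pi else Real.pi := by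
  have h : HasSum (fun m : ℕ => ∫ θ in (0 : ℝ)..2 * Real.pi,
      b m * Real.cos (m * θ) * Real.cos (n * θ))
      (∫ θ in (0 : ℝ)..2 * Real.pi, v θ * Real.cos (n * θ)) := by
    refine intervalIntegral.hasSum_integral_of_dominated_convergence (fun m _ => |b m|)
      (fun m => (Continuous.aestronglyMeasurable (by fun_prop))) ?_ ?_ ?_ ?_
    · refine fun m => Eventually.of_forall fun θ _ => ?_
      rw [Real.norm_eq_abs, abs_mul, abs_mul, mul_assoc]
      exact mul_le_of_le_one_right (abs_nonneg _)
        (mul_le_one₀ (Real.abs_cos_le_one _) (abs_nonneg _) (Real.abs_cos_le_one _))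
    · exact Eventually.of_forall fun θ _ => hb
    · exact intervalIntegrable_const
    · exact Eventually.of_forall fun θ _ => (hv θ).mul_right _
  refine h.unique ?_
  have h' := hasSum_ite_eq n (b n * if n = 0 then 2 * Real.pi else Real.pi)
  refine h'.congr_fun fun m => ?_
  simp_rw [mul_assoc]
  rw [intervalIntegral.integral_const_mul, integral_cos_mul_cos_nat]
  by_cases hmn : m = n <;> simp [hmn]

/-! ### From bounded means to convergent coefficients -/

theorem intervalIntegral_abs_le_of_ae_le {v g : ℝ → ℝ} {a b : ℝ} (hab : a ≤ b)
    (hv : IntervalIntegrable v volume a b) (hg : IntervalIntegrable g volume a b)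
    (hgv : ∀ᵐ θ ∂(volume.restrict (Set.Ioo a b)), g θ ≤ v θ) :
    ∫ θ in a..b, |v θ| ≤ (∫ θ in a..b, v θ) + 2 * ∫ θ in a..b, |g θ| := by
  rw [← intervalIntegral.integral_const_mul, ← intervalIntegral.integral_add hv
    (hg.abs.const_mul 2)]
  refine intervalIntegral.integral_mono_ae_restrict hab hv.abs (hv.add (hg.abs.const_mul 2)) ?_
  rw [← restrict_Ioo_eq_restrict_Icc]
  filter_upwards [hgv] with θ hθ
  rcases abs_cases (v θ) with h | h <;> linarith [abs_nonneg (g θ), neg_abs_le (g θ)]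

/-- Let `u r θ = ∑ c n r ^ n cos (n θ)` have bounded `L¹` means as `r → 1⁻` and converge in `L¹` on
compact subintervals of `(0, 2π)`. Then the sequence `c` converges. -/
theorem exists_tendsto_coeff_of_bounded_means {c : ℕ → ℝ} {u : ℝ → ℝ → ℝ} {φ : ℝ → ℝ} {M : ℝ}
    (hc : ∀ r ∈ Set.Ico (0 : ℝ) 1, Summable fun n => |c n * r ^ n|)
    (hu : ∀ r ∈ Set.Ico (0 : ℝ) 1, ∀ θ,
      HasSum (fun n : ℕ => c n * r ^ n * Real.cos (n * θ)) (u r θ))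
    (hM : ∀ᶠ r in 𝓝[<] 1, ∫ θ in (0 : ℝ)..2 * Real.pi, |u r θ| ≤ M)
    (hφ : ∀ α β, 0 < α → α ≤ β → β < 2 * Real.pi → IntervalIntegrable φ volume α β ∧
      Tendsto (fun r => ∫ θ in α..β, |u r θ - φ θ|) (𝓝[<] 1) (𝓝 0)) :
    ∃ a, Tendsto c atTop (𝓝 a) := by
  have hπ := Real.pi_pos
  have hcont : ∀ᶠ r in 𝓝[<] (1 : ℝ), Continuous (u r) := by
    filter_upwards [Ioo_mem_nhdsLT (zero_lt_one' ℝ)] with r hr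
    exact continuous_of_hasSum_mul_cos (hc r ⟨hr.1.le, hr.2⟩) (hu r ⟨hr.1.le, hr.2⟩)
  have hφM : ∀ α β, 0 < α → α ≤ β → β < 2 * Real.pi → ∫ θ in α..β, |φ θ| ≤ M := by
    intro α β hα hαβ hβ
    obtain ⟨hi, hl⟩ := hφ α β hα hαβ hβ
    refine ge_of_tendsto (x := 𝓝[<] (1 : ℝ)) (f := fun r => M + ∫ θ in α..β, |u r θ - φ θ|)
      (by simpa using hl.const_add M) ?_
    filter_upwards [hcont, hM] with r hr hMr
    have hi' := hr.intervalIntegrable (μ := volume) α β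
    calc ∫ θ in α..β, |φ θ| ≤ ∫ θ in α..β, (|u r θ| + |u r θ - φ θ|) := by
          refine intervalIntegral.integral_mono_on hαβ hi.abs
            (hi'.abs.add (hi'.sub hi).abs) fun θ _ => ?_
          have := abs_sub (u r θ) (u r θ - φ θ)
          rwa [sub_sub_cancel] at this
      _ = (∫ θ in α..β, |u r θ|) + ∫ θ in α..β, |u r θ - φ θ| :=
          intervalIntegral.integral_add hi'.abs (hi'.sub hi).abs
      _ ≤ M + ∫ θ in α..β, |u r θ - φ θ| := by
          gcongr
          refine le_trans ?_ hMr
          exact intervalIntegral.integral_mono_interval hα.le hαβ hβ.le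
            (Eventually.of_forall fun θ => abs_nonneg _) (hr.abs.intervalIntegrable _ _)
  have hφi : IntervalIntegrable φ volume 0 (2 * Real.pi) := by
    rw [intervalIntegrable_iff_integrableOn_Ioc_of_le (by positivity)]
    have hd : Tendsto (fun n : ℕ => 1 / ((n : ℝ) + 1)) atTop (𝓝 0) :=
      tendsto_one_div_add_atTop_nhds_zero_nat
    have hpos : ∀ n : ℕ, 0 < 1 / ((n : ℝ) + 1) := fun n => by positivity
    -- With `π > 3`, this keeps the endpoints of the exhausting intervals in order.
    have hle : ∀ n : ℕ, 1 / ((n : ℝ) + 1) ≤ 1 := fun n => by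
      rw [div_le_one (by positivity)]
      linarith [(Nat.cast_nonneg n : (0 : ℝ) ≤ n)]
    have h3 := Real.pi_gt_three
    refine integrableOn_Ioc_of_intervalIntegral_norm_bounded (l := atTop) (I := M)
      (a := fun n : ℕ => 1 / ((n : ℝ) + 1)) (b := fun n : ℕ => 2 * Real.pi - 1 / ((n : ℝ) + 1))
      (fun n => ?_) hd (by simpa using hd.const_sub (2 * Real.pi)) (Eventually.of_forall fun n => ?_)
    · have hn := hpos n
      have hn' := hle n
      exact (intervalIntegrable_iff_integrableOn_Ioc_of_le (by linarith)).1
        (hφ _ _ hn (by linarith) (by linarith)).1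
    · have hn := hpos n
      have hn' := hle n
      rw [← intervalIntegral.integral_of_le (by linarith)]
      exact hφM _ _ hn (by linarith) (by linarith)
  have hcoeff : ∀ n : ℕ, n ≠ 0 → Real.pi * c n =
      2 * Real.pi * c 0 + ∫ θ in (0 : ℝ)..2 * Real.pi, φ θ * (Real.cos (n * θ) - 1) := by
    intro n hn
    have hlim := tendsto_intervalIntegral_mul_of_vanish_endpoints
      (h := fun θ => Real.cos (n * θ) - 1) (by positivity) hcont hM hφi (by fun_prop) (by simp)
      (by
        have := Real.cos_nat_mul_two_pi n
        simp [this])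
      fun α β hα hαβ hβ => (hφ α β hα hαβ hβ).2
    have hlim' : Tendsto (fun r : ℝ => Real.pi * (c n * r ^ n) - 2 * Real.pi * c 0) (𝓝[<] 1)
        (𝓝 (Real.pi * (c n * 1 ^ n) - 2 * Real.pi * c 0)) :=
      (Continuous.tendsto (by fun_prop) 1).mono_left nhdsWithin_le_nhds
    have heq : (fun r : ℝ => Real.pi * (c n * r ^ n) - 2 * Real.pi * c 0) =ᶠ[𝓝[<] 1]
        fun r => ∫ θ in (0 : ℝ)..2 * Real.pi, u r θ * (Real.cos (n * θ) - 1) := by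
      filter_upwards [Ioo_mem_nhdsLT (zero_lt_one' ℝ), hcont] with r hr hur
      have hr' : r ∈ Set.Ico (0 : ℝ) 1 := ⟨hr.1.le, hr.2⟩
      have e1 := integral_mul_cos_of_hasSum_mul_cos (hc r hr') (hu r hr') n
      have e0 := integral_mul_cos_of_hasSum_mul_cos (hc r hr') (hu r hr') 0
      simp only [Nat.cast_zero, zero_mul, Real.cos_zero, mul_one, pow_zero, if_true] at e0
      rw [if_neg hn] at e1
      simp_rw [mul_sub, mul_one]
      rw [intervalIntegral.integral_sub (Continuous.intervalIntegrable (by fun_prop) _ _)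
        (hur.intervalIntegrable _ _), e0, e1]
      ring
    have := tendsto_nhds_unique (hlim'.congr' heq) hlim
    rw [one_pow, mul_one] at this
    linarith
  -- The `0` is the Riemann–Lebesgue limit of `∫ φ cos (n θ)`.
  refine ⟨(2 * Real.pi * c 0 + (0 - ∫ θ in (0 : ℝ)..2 * Real.pi, φ θ)) / Real.pi, ?_⟩
  have hRL := tendsto_integral_mul_cos_nat (by positivity) hφi
  refine (((hRL.sub_const (∫ θ in (0 : ℝ)..2 * Real.pi, φ θ)).const_add
    (2 * Real.pi * c 0)).div_const Real.pi).congr' ?_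
  filter_upwards [eventually_ne_atTop 0] with n hn
  rw [div_eq_iff hπ.ne', mul_comm (c n), hcoeff n hn]
  simp_rw [mul_sub, mul_one]
  rw [intervalIntegral.integral_sub (hφi.mul_continuousOn (by fun_prop)) hφi]

/-! ### Reduction to bounded means -/

theorem mainTheorem3 (c : ℕ → ℝ) (F : ℂ → ℂ) (U : ℂ → ℝ)
    (hF : ∀ z ∈ Metric.ball (0 : ℂ) 1, HasSum (fun n : ℕ => (c n : ℂ) * z ^ n) (F z))
    (hU : ∀ z ∈ Metric.ball (0 : ℂ) 1, U z = (F z).re)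
    (hboundary : HasL1LocBoundaryBehavior U (Metric.sphere (0 : ℂ) 1 \ {1}))
    (θ₀ : ℝ) (hθ₀ : θ₀ ∈ Set.Ioo 0 Real.pi)
    (hnear :
      -- a uniform lower bound near `1`
      (∃ C : ℝ, 0 ≤ C ∧ ∀ θ ∈ Set.Ioo (-θ₀) θ₀, ∀ r ∈ Set.Ico (0 : ℝ) 1,
        -C ≤ U (r * Complex.exp (θ * Complex.I))) ∨
      -- a uniform `L¹` bound near `1`
      (∃ M : ℝ, ∀ r ∈ Set.Ioo (0 : ℝ) 1,
        (∫ θ in (-θ₀)..θ₀, |U (r * Complex.exp (θ * Complex.I))|) ≤ M) ∨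
      -- an integrable lower bound together with polynomial growth near `1`
      (∃ (g : ℝ → ℝ) (k : ℕ), IntegrableOn g (Set.Ioo (-θ₀) θ₀) ∧
        (∃ C : ℝ, ∀ θ ∈ Set.Ioo (-θ₀) θ₀, ∀ r ∈ Set.Ico (0 : ℝ) 1,
          |U (r * Complex.exp (θ * Complex.I))| ≤ C * ((1 - r) ^ k)⁻¹) ∧
        (∀ r ∈ Set.Ico (0 : ℝ) 1, ∀ᵐ θ ∂(volume.restrict (Set.Ioo (-θ₀) θ₀)),
          g θ ≤ U (r * Complex.exp (θ * Complex.I))))) :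
    ∃ a : ℝ, Tendsto c atTop (𝓝 a) ∧
      Tendsto (fun r : ℝ => (1 - r) * U r) (𝓝[<] 1) (𝓝 a) := by
  obtain ⟨f, hf⟩ := hboundary
  obtain ⟨hθ, hθπ⟩ := hθ₀
  set u : ℝ → ℝ → ℝ := fun r θ => U (r * Complex.exp (θ * Complex.I)) with hudef
  have hball : ∀ r ∈ Set.Ico (0 : ℝ) 1, ∀ θ : ℝ,
      (r * Complex.exp (θ * Complex.I) : ℂ) ∈ Metric.ball (0 : ℂ) 1 := by
    intro r hr θ
    rw [mem_ball_zero_iff, norm_mul, Complex.norm_exp_ofReal_mul_I, Complex.norm_real, mul_one,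
      Real.norm_eq_abs, abs_of_nonneg hr.1]
    exact hr.2
  have hu : ∀ r ∈ Set.Ico (0 : ℝ) 1, ∀ θ,
      HasSum (fun n : ℕ => c n * r ^ n * Real.cos (n * θ)) (u r θ) := by
    intro r hr θ
    have h := Complex.hasSum_re (hF _ (hball r hr θ))
    rw [← hU _ (hball r hr θ)] at h
    refine h.congr_fun fun n => ?_
    rw [mul_pow, ← Complex.exp_nat_mul, ← mul_assoc, ← Complex.ofReal_pow, ← Complex.ofReal_mul,
      Complex.re_ofReal_mul, ← mul_assoc, ← Complex.ofReal_natCast, ← Complex.ofReal_mul,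
      Complex.exp_ofReal_mul_I_re]
  have hUr : ∀ r ∈ Set.Ico (0 : ℝ) 1, HasSum (fun n => c n * r ^ n) (U r) := by
    intro r hr
    simpa [hudef] using hu r hr 0
  have hc : ∀ r ∈ Set.Ico (0 : ℝ) 1, Summable fun n => |c n * r ^ n| :=
    fun r hr => (hUr r hr).summable.abs
  have hcont : ∀ r ∈ Set.Ico (0 : ℝ) 1, Continuous (u r) :=
    fun r hr => continuous_of_hasSum_mul_cos (hc r hr) (hu r hr)
  have hper : ∀ r, Function.Periodic (u r) (2 * Real.pi) := by
    intro r θ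
    simp only [hudef]
    rw [Complex.ofReal_add, add_mul, Complex.exp_add]
    simp
  have hφ : ∀ α β, 0 < α → α ≤ β → β < 2 * Real.pi →
      IntervalIntegrable (fun θ : ℝ => f (Complex.exp (θ * Complex.I))) volume α β ∧
      Tendsto (fun r => ∫ θ in α..β, |u r θ - f (Complex.exp (θ * Complex.I))|) (𝓝[<] 1)
        (𝓝 0) := by
    intro α β hα hαβ hβ
    refine hf α β hαβ fun θ hθ => ⟨by simp [Complex.norm_exp_ofReal_mul_I], fun h => ?_⟩
    rw [Set.mem_singleton_iff] at h
    have hcos : Real.cos θ = 1 := by rw [← Complex.exp_ofReal_mul_I_re, h, Complex.one_re]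
    exact (hα.trans_le hθ.1).ne' ((Real.cos_eq_one_iff_of_lt_of_lt
      (by linarith [hθ.1]) (hθ.2.trans_lt hβ)).1 hcos)
  have hlt : ∀ᶠ r in 𝓝[<] (1 : ℝ), r ∈ Set.Ioo (0 : ℝ) 1 := Ioo_mem_nhdsLT (zero_lt_one' ℝ)
  obtain ⟨N, hN⟩ : ∃ N, ∀ᶠ r in 𝓝[<] (1 : ℝ),
      ∫ θ in θ₀..(2 * Real.pi - θ₀), |u r θ| ≤ N := by
    obtain ⟨hi, hl⟩ := hφ θ₀ (2 * Real.pi - θ₀) hθ (by linarith) (by linarith)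
    refine ⟨1 + ∫ θ in θ₀..(2 * Real.pi - θ₀), |f (Complex.exp (θ * Complex.I))|, ?_⟩
    filter_upwards [hlt, hl.eventually_lt_const zero_lt_one] with r hr hr1
    have hi' := (hcont r ⟨hr.1.le, hr.2⟩).intervalIntegrable (μ := volume) θ₀ (2 * Real.pi - θ₀)
    refine le_trans ?_ (add_le_add_left hr1.le _)
    rw [← intervalIntegral.integral_add (hi'.sub hi).abs hi.abs]
    refine intervalIntegral.integral_mono_on (by linarith) hi'.abs
      ((hi'.sub hi).abs.add hi.abs) fun θ _ => ?_
    simpa using abs_add_le (u r θ - f (Complex.exp (θ * Complex.I)))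
      (f (Complex.exp (θ * Complex.I)))
  have hsplit : ∀ v : ℝ → ℝ, Continuous v → Function.Periodic v (2 * Real.pi) →
      (∫ θ in (-θ₀)..θ₀, v θ) + (∫ θ in θ₀..(2 * Real.pi - θ₀), v θ) =
        ∫ θ in (0 : ℝ)..2 * Real.pi, v θ := by
    intro v hv hp
    rw [intervalIntegral.integral_add_adjacent_intervals (hv.intervalIntegrable _ _)
      (hv.intervalIntegrable _ _)]
    have := hp.intervalIntegral_add_eq (-θ₀) 0
    rwa [zero_add, neg_add_eq_sub] at this
  -- The total integral is `2π c 0` and the far arc contributes at least `-N`, so the integral of `u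
  -- r` near `1` is bounded above; the lower bound `g` turns this into an `L¹` bound.
  have hlower : ∀ g : ℝ → ℝ, IntegrableOn g (Set.Ioo (-θ₀) θ₀) →
      (∀ r ∈ Set.Ico (0 : ℝ) 1, ∀ᵐ θ ∂(volume.restrict (Set.Ioo (-θ₀) θ₀)), g θ ≤ u r θ) →
      ∃ M, ∀ᶠ r in 𝓝[<] (1 : ℝ), ∫ θ in (-θ₀)..θ₀, |u r θ| ≤ M := by
    intro g hg hgu
    refine ⟨c 0 * (2 * Real.pi) + N + 2 * ∫ θ in (-θ₀)..θ₀, |g θ|, ?_⟩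
    filter_upwards [hlt, hN] with r hr hNr
    have hr' : r ∈ Set.Ico (0 : ℝ) 1 := ⟨hr.1.le, hr.2⟩
    have hgi : IntervalIntegrable g volume (-θ₀) θ₀ :=
      (intervalIntegrable_iff_integrableOn_Ioo_of_le (by linarith)).2 hg
    have h1 := intervalIntegral_abs_le_of_ae_le (by linarith)
      ((hcont r hr').intervalIntegrable _ _) hgi (hgu r hr')
    have h2 := hsplit _ (hcont r hr') (hper r)
    have h3 := integral_mul_cos_of_hasSum_mul_cos (hc r hr') (hu r hr') 0
    simp only [Nat.cast_zero, zero_mul, Real.cos_zero, mul_one, pow_zero, if_true] at h3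
    have h4 := intervalIntegral.abs_integral_le_integral_abs (μ := volume) (f := u r)
      (show θ₀ ≤ 2 * Real.pi - θ₀ by linarith)
    have h5 := neg_abs_le (∫ θ in θ₀..(2 * Real.pi - θ₀), u r θ)
    linarith
  obtain ⟨M, hM⟩ : ∃ M, ∀ᶠ r in 𝓝[<] (1 : ℝ), ∫ θ in (-θ₀)..θ₀, |u r θ| ≤ M := by
    rcases hnear with ⟨C, -, hC⟩ | ⟨M, hM⟩ | ⟨g, -, hg, -, hgu⟩
    · refine hlower (fun _ => -C) (integrableOn_const (by simp)) fun r hr => ?_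
      filter_upwards [ae_restrict_mem measurableSet_Ioo] with θ hm using hC θ hm r hr
    · exact ⟨M, hlt.mono hM⟩
    · exact hlower g hg hgu
  have hmean : ∀ᶠ r in 𝓝[<] (1 : ℝ), ∫ θ in (0 : ℝ)..2 * Real.pi, |u r θ| ≤ M + N := by
    filter_upwards [hlt, hM, hN] with r hr hMr hNr
    rw [← hsplit _ (hcont r ⟨hr.1.le, hr.2⟩).abs fun θ => congrArg abs (hper r θ)]
    exact add_le_add hMr hNr
  obtain ⟨a, ha⟩ := exists_tendsto_coeff_of_bounded_means hc hu hmean hφ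
  exact ⟨a, ha, tendsto_one_sub_mul_of_tendsto hUr ha⟩
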